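/- Let $(M,g)$ be a connected four-dimensional smooth pseudo-Riemannian manifold without boundary (a space-time manifold), where $g$ is a smooth symmetric nondegenerate metric of arbitrary signature. A Killing vector field is a smooth vector field $X$ on $M$ with $L_X g=0$, i.e. in every local chart and for all indices $i,j$, $$\sum_{s} X^s\,\frac{\partial g_{ij}}{\partial x^s}+\sum_{s} g_{sj}\,\frac{\partial X^s}{\partial x^i}+\sum_{s} g_{is}\,\frac{\partial X^s}{\partial x^j}=0 .$$ Then $M$ has at most ten Killing vector fields that are linearly independent over $\mathbb{R}$: every family of Killing vector fields on $M$ that is linearly independent over $\mathbb{R}$ has at most ten members. -/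

import Mathlib

open scoped Manifold ContDiff Bundle

noncomputable section

/-- A smooth pseudo-Riemannian metric (of arbitrary signature) on a smooth `n`-dimensional
manifold `M` without boundary: a smooth section `g` of the bundle of bilinear forms on the tangent
spaces which is symmetric and nondegenerate at every point. -/
structure PseudoRiemannianMetric (n : ℕ) (M : Type*) [TopologicalSpace M]
    [ChartedSpace (EuclideanSpace ℝ (Fin n)) M] [IsManifold (𝓡 n) ∞ M] where
  /-- The bilinear form on each tangent space. -/
  form : ∀ x : M, TangentSpace (𝓡 n) x →L[ℝ] TangentSpace (𝓡 n) x →L[ℝ] ℝ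
  form_symm : ∀ (x : M) (v w : TangentSpace (𝓡 n) x), form x v w = form x w v
  form_nondegenerate : ∀ (x : M) (v : TangentSpace (𝓡 n) x), (∀ w, form x v w = 0) → v = 0
  form_smooth : ContMDiff (𝓡 n)
    ((𝓡 n).prod 𝓘(ℝ, EuclideanSpace ℝ (Fin n) →L[ℝ] EuclideanSpace ℝ (Fin n) →L[ℝ] ℝ)) ∞
    (fun x : M ↦ Bundle.TotalSpace.mk'
      (EuclideanSpace ℝ (Fin n) →L[ℝ] EuclideanSpace ℝ (Fin n) →L[ℝ] ℝ)
      (E := fun x : M ↦ TangentSpace (𝓡 n) x →L[ℝ] TangentSpace (𝓡 n) x →L[ℝ] ℝ) x (form x))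

section Coordinates

variable {n : ℕ} {M : Type*} [TopologicalSpace M]
  [ChartedSpace (EuclideanSpace ℝ (Fin n)) M]

/-- The partial derivative `∂f/∂xⁱ` at the point `y` of `ℝⁿ`. -/
def partialDeriv (i : Fin n) (f : EuclideanSpace ℝ (Fin n) → ℝ) (y : EuclideanSpace ℝ (Fin n)) :
    ℝ :=
  fderiv ℝ f y (EuclideanSpace.single i 1)

/-- The coordinate vector `∂/∂xⁱ` of the chart `e`, at the point of `M` with coordinates `y`. -/
def coordVector (e : OpenPartialHomeomorph M (EuclideanSpace ℝ (Fin n))) (i : Fin n)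
    (y : EuclideanSpace ℝ (Fin n)) : TangentSpace (𝓡 n) (e.symm y) :=
  mfderiv (𝓡 n) (𝓡 n) e.symm y
    (EuclideanSpace.single i (1 : ℝ) : EuclideanSpace ℝ (Fin n))

/-- The component `Xⁱ` of the vector field `X` in the chart `e`, as a function of the
coordinates. -/
def vectorComponent (e : OpenPartialHomeomorph M (EuclideanSpace ℝ (Fin n)))
    (X : ∀ x : M, TangentSpace (𝓡 n) x) (i : Fin n) (y : EuclideanSpace ℝ (Fin n)) : ℝ :=
  (EuclideanSpace.proj i : EuclideanSpace ℝ (Fin n) →L[ℝ] ℝ)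
    (mfderiv (𝓡 n) (𝓡 n) e (e.symm y) (X (e.symm y)))

variable [IsManifold (𝓡 n) ∞ M]

/-- The component `g_ij = g(∂/∂xⁱ, ∂/∂xʲ)` of the metric in the chart `e`, as a function of the
coordinates. -/
def metricComponent (g : PseudoRiemannianMetric n M)
    (e : OpenPartialHomeomorph M (EuclideanSpace ℝ (Fin n))) (i j : Fin n)
    (y : EuclideanSpace ℝ (Fin n)) : ℝ :=
  g.form (e.symm y) (coordVector e i y) (coordVector e j y)

/-- The component `(L_X g)_ij` in the chart `e` of the Lie derivative of the metric `g` along the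
vector field `X`, as a function of the coordinates:
`∑ₛ Xˢ ∂g_ij/∂xˢ + ∑ₛ g_sj ∂Xˢ/∂xⁱ + ∑ₛ g_is ∂Xˢ/∂xʲ`. -/
def lieDerivMetricComponent (g : PseudoRiemannianMetric n M) (X : ∀ x : M, TangentSpace (𝓡 n) x)
    (e : OpenPartialHomeomorph M (EuclideanSpace ℝ (Fin n))) (i j : Fin n)
    (y : EuclideanSpace ℝ (Fin n)) : ℝ :=
  ∑ s, vectorComponent e X s y * partialDeriv s (metricComponent g e i j) y
    + ∑ s, metricComponent g e s j y * partialDeriv i (vectorComponent e X s) y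
    + ∑ s, metricComponent g e i s y * partialDeriv j (vectorComponent e X s) y

/-- A Killing vector field of `(M, g)`: a smooth vector field `X` on `M` with `L_X g = 0`, that is,
all components of `L_X g` vanish in every chart of `M`. -/
structure IsKillingField (g : PseudoRiemannianMetric n M) (X : ∀ x : M, TangentSpace (𝓡 n) x) :
    Prop where
  smooth : ContMDiff (𝓡 n) (𝓡 n).tangent ∞ (fun x : M ↦ (⟨x, X x⟩ : TangentBundle (𝓡 n) M))
  lieDeriv_eq_zero : ∀ e ∈ atlas (EuclideanSpace ℝ (Fin n)) M, ∀ y ∈ e.target, ∀ i j : Fin n,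
    lieDerivMetricComponent g X e i j y = 0

end Coordinates

end

/-!
A Killing field `X` satisfies a linear first-order system whose differentiation closes up: by the
Christoffel permutation trick, the second derivative of `X` is a linear expression in `X` and `DX`,
with coefficients built from the metric and its first two derivatives
(`KillingOn.norm_second_fderiv_le` extracts the resulting bound). Nondegeneracy of the metric gives
locally `‖D²X‖ ≤ K (‖X‖ + ‖DX‖)`, and Gronwall's inequality along segments shows that each point
has a neighbourhood on which `X` vanishes as soon as its first jet vanishes at one point of it
(`exists_isOpen_killing_eq_zero`). Since the neighbourhood depends on the metric alone, not on that
point, the set of points near which `X` vanishes is closed as well as open, so on a connected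
manifold a Killing field is determined by its first jet at one point
(`eq_zero_of_mem_killingSubmodule`).

The first jet at `p` consists of the components of `X` and of the matrix `G(∂ᵢX, ∂ⱼ)`. When `X`
vanishes at `p`, the Killing equation makes this matrix skew-symmetric, so `n + n(n-1)/2` numbers
determine the field (`killingJet_injective`); for `n = 4` there are ten of them.

The local analysis is coordinate-free on a normed space: in a chart, the metric and the field become
functions `metricInChart` and `fieldInChart` on `ℝⁿ`, and the component form of the equation is
extended bilinearly to all pairs of vectors (`IsKillingField.killingOn`).
-/

noncomputable section

set_option maxSynthPendingDepth 3
set_option synthInstance.maxHeartbeats 200000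

open Set Filter Topology

/-! ### Unique continuation for the Killing equation on a normed space -/

section Local

variable {E : Type*} [NormedAddCommGroup E] [NormedSpace ℝ E]

/-- The Killing equation on a set `U` of a normed space, for a field of bilinear forms `G` and a
vector field `X`: the Lie derivative `(L_X G)(u, v)` vanishes at the points of `U`. -/
def KillingOn (G : E → E →L[ℝ] E →L[ℝ] ℝ) (X : E → E) (U : Set E) : Prop :=
  ∀ y ∈ U, ∀ u v : E,
    fderiv ℝ G y (X y) u v + G y (fderiv ℝ X y u) v + G y u (fderiv ℝ X y v) = 0

variable {G : E → E →L[ℝ] E →L[ℝ] ℝ} {X : E → E} {U : Set E}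

/-- The derivative of the Killing equation in the direction `w`. -/
lemma KillingOn.fderiv_eq_zero (hU : IsOpen U) (hG : ContDiffOn ℝ 2 G U)
    (hX : ContDiffOn ℝ 2 X U) (hK : KillingOn G X U) {y : E} (hy : y ∈ U) (w u v : E) :
    fderiv ℝ (fderiv ℝ G) y w (X y) u v + fderiv ℝ G y (fderiv ℝ X y w) u v
      + (fderiv ℝ G y w (fderiv ℝ X y u) v + G y (fderiv ℝ (fderiv ℝ X) y w u) v)
      + (fderiv ℝ G y w u (fderiv ℝ X y v) + G y u (fderiv ℝ (fderiv ℝ X) y w v)) = 0 := by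
  have hGy := hG.contDiffAt (hU.mem_nhds hy)
  have hXy := hX.contDiffAt (hU.mem_nhds hy)
  have hG0 : HasFDerivAt G (fderiv ℝ G y) y := (hGy.differentiableAt (by simp)).hasFDerivAt
  have hX0 : HasFDerivAt X (fderiv ℝ X y) y := (hXy.differentiableAt (by simp)).hasFDerivAt
  have hG1 : HasFDerivAt (fderiv ℝ G) (fderiv ℝ (fderiv ℝ G) y) y :=
    ((hGy.fderiv_right (m := 1) (by norm_num)).differentiableAt (by simp)).hasFDerivAt
  have hX1 : HasFDerivAt (fderiv ℝ X) (fderiv ℝ (fderiv ℝ X) y) y :=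
    ((hXy.fderiv_right (m := 1) (by norm_num)).differentiableAt (by simp)).hasFDerivAt
  have cu := hasFDerivAt_const (𝕜 := ℝ) u y
  have cv := hasFDerivAt_const (𝕜 := ℝ) v y
  have h := (((hG1.clm_apply hX0).clm_apply cu).clm_apply cv).add
    ((hG0.clm_apply (hX1.clm_apply cu)).clm_apply cv) |>.add
    ((hG0.clm_apply cu).clm_apply (hX1.clm_apply cv))
  have h0 : HasFDerivAt (fun _ : E ↦ (0 : ℝ)) (0 : E →L[ℝ] ℝ) y := hasFDerivAt_const 0 y
  have h1 := h.unique (h0.congr_of_eventuallyEq (by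
    filter_upwards [hU.mem_nhds hy] with z hz using hK z hz u v))
  have h2 := DFunLike.congr_fun h1 w
  simp at h2
  linarith

/-- The second derivative of a Killing field is determined by its first jet. The bilinear expression
`T(w, u, v) = G(D²X(w, u), v)` is symmetric in its first two arguments, and the differentiated
Killing equation expresses its symmetrization in the last two arguments through the first jet of
`X`; as in the construction of the Christoffel symbols, the three cyclic permutations determine
`T`. -/
lemma KillingOn.norm_second_fderiv_le (hU : IsOpen U) (hG : ContDiffOn ℝ 2 G U)
    (hX : ContDiffOn ℝ 2 X U) (hsymm : ∀ y ∈ U, ∀ u v, G y u v = G y v u)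
    (hK : KillingOn G X U) {y : E} (hy : y ∈ U) (w u : E) :
    ‖G y (fderiv ℝ (fderiv ℝ X) y w u)‖ ≤
      3 / 2 * (‖fderiv ℝ (fderiv ℝ G) y‖ * ‖X y‖ + 3 * ‖fderiv ℝ G y‖ * ‖fderiv ℝ X y‖)
        * ‖w‖ * ‖u‖ := by
  have hXy := hX.contDiffAt (hU.mem_nhds hy)
  have hT : ∀ a b, fderiv ℝ (fderiv ℝ X) y a b = fderiv ℝ (fderiv ℝ X) y b a := fun a b ↦
    (hXy.isSymmSndFDerivAt (by simp)).eq a b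
  set B := ‖fderiv ℝ (fderiv ℝ G) y‖ * ‖X y‖ + 3 * ‖fderiv ℝ G y‖ * ‖fderiv ℝ X y‖ with hB
  have key : ∀ a b c : E, |G y (fderiv ℝ (fderiv ℝ X) y a b) c
      + G y (fderiv ℝ (fderiv ℝ X) y a c) b| ≤ B * (‖a‖ * ‖b‖ * ‖c‖) := by
    intro a b c
    have h := hK.fderiv_eq_zero hU hG hX hy a b c
    rw [hsymm y hy b] at h
    have h1 : |fderiv ℝ (fderiv ℝ G) y a (X y) b c| ≤
        ‖fderiv ℝ (fderiv ℝ G) y‖ * ‖a‖ * ‖X y‖ * ‖b‖ * ‖c‖ := by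
      refine ((fderiv ℝ (fderiv ℝ G) y a (X y)).le_opNorm₂ b c).trans ?_
      gcongr
      exact (fderiv ℝ (fderiv ℝ G) y).le_opNorm₂ a (X y)
    have h3 : ∀ p q r : E, |fderiv ℝ G y p q r| ≤ ‖fderiv ℝ G y‖ * ‖p‖ * ‖q‖ * ‖r‖ := by
      intro p q r
      refine ((fderiv ℝ G y p).le_opNorm₂ q r).trans ?_
      gcongr
      exact (fderiv ℝ G y).le_opNorm p
    have ha := (fderiv ℝ X y).le_opNorm a
    have hb := (fderiv ℝ X y).le_opNorm b
    have hc := (fderiv ℝ X y).le_opNorm c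
    have h4 := (h3 (fderiv ℝ X y a) b c).trans
      (show _ ≤ ‖fderiv ℝ G y‖ * (‖fderiv ℝ X y‖ * ‖a‖) * ‖b‖ * ‖c‖ by gcongr)
    have h5 := (h3 a (fderiv ℝ X y b) c).trans
      (show _ ≤ ‖fderiv ℝ G y‖ * ‖a‖ * (‖fderiv ℝ X y‖ * ‖b‖) * ‖c‖ by gcongr)
    have h6 := (h3 a b (fderiv ℝ X y c)).trans
      (show _ ≤ ‖fderiv ℝ G y‖ * ‖a‖ * ‖b‖ * (‖fderiv ℝ X y‖ * ‖c‖) by gcongr)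
    rw [abs_le] at h1 h4 h5 h6 ⊢
    rw [hB]
    constructor <;> linarith [h1.1, h1.2, h4.1, h4.2, h5.1, h5.2, h6.1, h6.2]
  refine ContinuousLinearMap.opNorm_le_bound _ (by positivity) fun v ↦ ?_
  -- the cyclic permutations of `key`, to be combined with signs `+`, `+`, `-`
  have k1 := key w u v
  have k2 := key u v w
  have k3 := key v w u
  rw [hT u w] at k2
  rw [hT v w, hT v u] at k3
  rw [Real.norm_eq_abs]
  rw [abs_le] at *
  constructor <;> linarith [k1.1, k1.2, k2.1, k2.2, k3.1, k3.2]

/-- Gronwall's inequality along the segments of a convex set: a vector field whose second derivative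
is bounded by its first jet vanishes on the set if its first jet vanishes at one point. -/
lemma eq_zero_of_norm_second_fderiv_le {V : Set E} {K : ℝ} (hV : Convex ℝ V) (hVo : IsOpen V)
    (hK : 0 ≤ K) (hX : ContDiffOn ℝ 2 X V)
    (hbd : ∀ y ∈ V, ‖fderiv ℝ (fderiv ℝ X) y‖ ≤ K * (‖X y‖ + ‖fderiv ℝ X y‖))
    {q : E} (hq : q ∈ V) (h0 : X q = 0) (h1 : fderiv ℝ X q = 0) {y : E} (hy : y ∈ V) :
    X y = 0 := by
  have hmem : ∀ t ∈ Icc (0 : ℝ) 1, q + t • (y - q) ∈ V := fun t ht ↦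
    hV.add_smul_sub_mem hq hy ht
  have hc : ∀ t : ℝ, HasDerivAt (fun t : ℝ ↦ q + t • (y - q)) (y - q) t := fun t ↦ by
    simpa using ((hasDerivAt_id t).smul_const (y - q)).const_add q
  have hd : ∀ t ∈ Icc (0 : ℝ) 1, HasDerivAt
      (fun t : ℝ ↦ (X (q + t • (y - q)), fderiv ℝ X (q + t • (y - q))))
      (fderiv ℝ X (q + t • (y - q)) (y - q),
        fderiv ℝ (fderiv ℝ X) (q + t • (y - q)) (y - q)) t := by
    intro t ht
    have hXy := hX.contDiffAt (hVo.mem_nhds (hmem t ht))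
    have hX0 := (hXy.differentiableAt (by simp)).hasFDerivAt
    have hX1 := ((hXy.fderiv_right (m := 1) (by norm_num)).differentiableAt (by simp)).hasFDerivAt
    exact (hX0.comp_hasDerivAt t (hc t)).prodMk (hX1.comp_hasDerivAt t (hc t))
  have := eq_zero_of_abs_deriv_le_mul_abs_self_of_eq_zero_right
    (K := (1 + 2 * K) * ‖y - q‖) (fun t ht ↦ (hd t ht).continuousAt.continuousWithinAt)
    (fun t ht ↦ (hd t (Ico_subset_Icc_self ht)).hasDerivWithinAt) (by simp [h0, h1]) ?_ 1 (by simp)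
  · simpa using congrArg Prod.fst this
  · intro t ht
    have hb := hbd _ (hmem t (Ico_subset_Icc_self ht))
    set z := q + t • (y - q)
    have m0 := norm_fst_le (X z, fderiv ℝ X z)
    have m1 := norm_snd_le (X z, fderiv ℝ X z)
    set m := ‖(X z, fderiv ℝ X z)‖
    simp only at m0 m1
    have hm : 0 ≤ m := norm_nonneg _
    refine norm_prod_le_iff.2 ⟨?_, ?_⟩
    · refine ((fderiv ℝ X z).le_opNorm _).trans ?_
      have : ‖fderiv ℝ X z‖ * ‖y - q‖ ≤ m * ‖y - q‖ := by gcongr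
      nlinarith [mul_nonneg (mul_nonneg hK hm) (norm_nonneg (y - q))]
    · refine ((fderiv ℝ (fderiv ℝ X) z).le_opNorm _).trans ?_
      have : ‖fderiv ℝ (fderiv ℝ X) z‖ ≤ K * (m + m) := hb.trans (by gcongr)
      have : ‖fderiv ℝ (fderiv ℝ X) z‖ * ‖y - q‖ ≤ K * (m + m) * ‖y - q‖ := by gcongr
      nlinarith [mul_nonneg hm (norm_nonneg (y - q))]

lemma ContDiffAt.exists_norm_fderiv_le {F : Type*} [NormedAddCommGroup F] [NormedSpace ℝ F]
    {f : E → F} {p : E} (h : ContDiffAt ℝ 2 f p) :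
    ∃ C > 0, ∀ᶠ y in 𝓝 p, ‖fderiv ℝ f y‖ ≤ C ∧ ‖fderiv ℝ (fderiv ℝ f) y‖ ≤ C := by
  have h1 : ContDiffAt ℝ 1 (fderiv ℝ f) p := h.fderiv_right (by norm_num)
  have c1 : ContinuousAt (fderiv ℝ f) p := h1.continuousAt
  have c2 : ContinuousAt (fderiv ℝ (fderiv ℝ f)) p :=
    (h1.fderiv_right (m := 0) (by norm_num)).continuousAt
  refine ⟨max (‖fderiv ℝ f p‖ + 1) (‖fderiv ℝ (fderiv ℝ f) p‖ + 1), by positivity, ?_⟩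
  filter_upwards [c1.norm.tendsto.eventually_lt_const (lt_add_one _),
    c2.norm.tendsto.eventually_lt_const (lt_add_one _)] with y hy1 hy2
  exact ⟨le_max_of_le_left hy1.le, le_max_of_le_right hy2.le⟩

/-- Unique continuation for Killing fields: every point has a neighbourhood on which a Killing
field vanishes as soon as its first jet vanishes at one point of the neighbourhood. The
neighbourhood depends on the metric only. -/
lemma exists_isOpen_killing_eq_zero [FiniteDimensional ℝ E] (hU : IsOpen U)
    (hG : ContDiffOn ℝ 2 G U) (hsymm : ∀ y ∈ U, ∀ u v, G y u v = G y v u)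
    {p : E} (hp : p ∈ U) (hnd : ∀ u, (∀ v, G p u v = 0) → u = 0) :
    ∃ V ⊆ U, IsOpen V ∧ p ∈ V ∧ ∀ X : E → E, ContDiffOn ℝ 2 X U → KillingOn G X U →
      ∀ q ∈ V, X q = 0 → fderiv ℝ X q = 0 → ∀ y ∈ V, X y = 0 := by
  have hker : (G p : E →ₗ[ℝ] E →L[ℝ] ℝ).ker = ⊥ := by
    refine LinearMap.ker_eq_bot'.2 fun u hu ↦ hnd u fun v ↦ ?_
    exact DFunLike.congr_fun hu v
  obtain ⟨k, hk, hanti⟩ := LinearMap.exists_antilipschitzWith _ hker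
  have hGp := hG.contDiffAt (hU.mem_nhds hp)
  have c0 : ContinuousAt G p := hGp.continuousAt
  obtain ⟨C, hC, e1⟩ := hGp.exists_norm_fderiv_le
  have hk' : (0 : ℝ) < k := hk
  have e0 : ∀ᶠ y in 𝓝 p, ‖G y - G p‖ < (2 * k : ℝ)⁻¹ := by
    have : Tendsto (fun y ↦ ‖G y - G p‖) (𝓝 p) (𝓝 0) := by
      simpa using (c0.tendsto.sub_const (G p)).norm
    exact this.eventually_lt_const (by positivity)
  obtain ⟨r, hr, hball⟩ := Metric.mem_nhds_iff.1
    (((eventually_mem_set.2 (hU.mem_nhds hp)).and (e0.and e1)))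
  have hVU : Metric.ball p r ⊆ U := fun y hy ↦ (hball hy).1
  refine ⟨Metric.ball p r, hVU, Metric.isOpen_ball, Metric.mem_ball_self hr, ?_⟩
  intro X hX hK q hq h0 h1 y hy
  refine eq_zero_of_norm_second_fderiv_le (K := 2 * k * (3 / 2 * (C + 3 * C))) (convex_ball p r)
    Metric.isOpen_ball (by positivity) (hX.mono hVU) ?_ hq h0 h1 hy
  intro z hz
  obtain ⟨hzU, b0, b1, b2⟩ := hball hz
  refine ContinuousLinearMap.opNorm_le_bound _ (by positivity) fun w ↦ ?_
  refine ContinuousLinearMap.opNorm_le_bound _ (by positivity) fun u ↦ ?_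
  have hle := hK.norm_second_fderiv_le hU hG hX hsymm hzU w u
  set s := fderiv ℝ (fderiv ℝ X) z w u
  -- near `p` the form `G z` inherits a lower bound from the nondegenerate form `G p`
  have l1 : ‖s‖ ≤ 2 * k * ‖G z s‖ := by
    have a1 : ‖s‖ ≤ k * ‖G p s‖ := by
      simpa [dist_eq_norm] using hanti.le_mul_dist s 0
    have a2 : ‖G p s‖ ≤ ‖G z s‖ + (2 * k : ℝ)⁻¹ * ‖s‖ := by
      have : G p s = G z s - (G z - G p) s := by simp
      rw [this]
      refine (norm_sub_le _ _).trans ?_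
      gcongr
      exact (G z - G p).le_of_opNorm_le b0.le s
    have a3 : k * ((2 * k : ℝ)⁻¹ * ‖s‖) = ‖s‖ / 2 := by field_simp
    nlinarith [mul_le_mul_of_nonneg_left a2 hk'.le]
  have l2 : ‖fderiv ℝ (fderiv ℝ G) z‖ * ‖X z‖ + 3 * ‖fderiv ℝ G z‖ * ‖fderiv ℝ X z‖ ≤
      (C + 3 * C) * (‖X z‖ + ‖fderiv ℝ X z‖) := by
    have a1 : ‖fderiv ℝ (fderiv ℝ G) z‖ * ‖X z‖ ≤ C * ‖X z‖ := by gcongr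
    have a2 : 3 * ‖fderiv ℝ G z‖ * ‖fderiv ℝ X z‖ ≤ 3 * C * ‖fderiv ℝ X z‖ := by gcongr
    nlinarith [mul_nonneg hC.le (norm_nonneg (fderiv ℝ X z)),
      mul_nonneg hC.le (norm_nonneg (X z))]
  calc ‖s‖ ≤ 2 * k * ‖G z s‖ := l1
    _ ≤ 2 * k * (3 / 2 * ((C + 3 * C) * (‖X z‖ + ‖fderiv ℝ X z‖)) * ‖w‖ * ‖u‖) := by
      gcongr
      exact hle.trans (by gcongr)
    _ = _ := by ring

end Local

/-! ### The metric and vector fields in a chart -/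

section Charts

variable {n : ℕ} {M : Type*} [TopologicalSpace M]
  [ChartedSpace (EuclideanSpace ℝ (Fin n)) M]

/-- The vector field `X` read in the chart `e`: a field of vectors on `ℝⁿ`, meaningful on the
target of `e`. Its components are the `vectorComponent e X i`. -/
def fieldInChart (e : OpenPartialHomeomorph M (EuclideanSpace ℝ (Fin n)))
    (X : ∀ x : M, TangentSpace (𝓡 n) x) (y : EuclideanSpace ℝ (Fin n)) :
    EuclideanSpace ℝ (Fin n) :=
  mfderiv (𝓡 n) (𝓡 n) e (e.symm y) (X (e.symm y))

lemma fieldInChart_add (e : OpenPartialHomeomorph M (EuclideanSpace ℝ (Fin n)))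
    (X Y : ∀ x : M, TangentSpace (𝓡 n) x) :
    fieldInChart e (X + Y) = fieldInChart e X + fieldInChart e Y :=
  funext fun y ↦ map_add (mfderiv (𝓡 n) (𝓡 n) e (e.symm y)) _ _

lemma fieldInChart_smul (e : OpenPartialHomeomorph M (EuclideanSpace ℝ (Fin n))) (c : ℝ)
    (X : ∀ x : M, TangentSpace (𝓡 n) x) :
    fieldInChart e (c • X) = c • fieldInChart e X :=
  funext fun y ↦ map_smul (mfderiv (𝓡 n) (𝓡 n) e (e.symm y)) _ _

variable [IsManifold (𝓡 n) ∞ M]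

/-- The metric `g` read in the chart `e`: a field of bilinear forms on `ℝⁿ`, meaningful on the
target of `e`. Its entries on the coordinate vectors are the `metricComponent g e i j`. -/
def metricInChart (g : PseudoRiemannianMetric n M)
    (e : OpenPartialHomeomorph M (EuclideanSpace ℝ (Fin n))) (y : EuclideanSpace ℝ (Fin n)) :
    EuclideanSpace ℝ (Fin n) →L[ℝ] EuclideanSpace ℝ (Fin n) →L[ℝ] ℝ :=
  let f : EuclideanSpace ℝ (Fin n) →L[ℝ] EuclideanSpace ℝ (Fin n) →L[ℝ] ℝ := g.form (e.symm y)
  let d : EuclideanSpace ℝ (Fin n) →L[ℝ] EuclideanSpace ℝ (Fin n) :=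
    mfderiv (𝓡 n) (𝓡 n) e.symm y
  f.bilinearComp d d

lemma metricInChart_symm (g : PseudoRiemannianMetric n M)
    (e : OpenPartialHomeomorph M (EuclideanSpace ℝ (Fin n))) (y u v : EuclideanSpace ℝ (Fin n)) :
    metricInChart g e y u v = metricInChart g e y v u :=
  g.form_symm _ _ _

lemma mdifferentiable_chartAt (p : M) :
    (chartAt (EuclideanSpace ℝ (Fin n)) p).MDifferentiable (𝓡 n) (𝓡 n) :=
  have : IsManifold (𝓡 n) 1 M := IsManifold.of_le (n := ∞) (by simp)
  mdifferentiable_chart p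

lemma metricInChart_nondegenerate (g : PseudoRiemannianMetric n M) (p : M)
    {y : EuclideanSpace ℝ (Fin n)} (hy : y ∈ (chartAt (EuclideanSpace ℝ (Fin n)) p).target)
    {u : EuclideanSpace ℝ (Fin n)}
    (hu : ∀ v, metricInChart g (chartAt (EuclideanSpace ℝ (Fin n)) p) y u v = 0) : u = 0 := by
  have hb := (mdifferentiable_chartAt (n := n) p).symm.mfderiv_bijective hy
  refine hb.1 ((g.form_nondegenerate _ _ fun w ↦ ?_).trans (map_zero _).symm)
  obtain ⟨v, rfl⟩ := hb.2 w
  exact hu v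

lemma fieldInChart_eq_zero_iff (p : M) (X : ∀ x : M, TangentSpace (𝓡 n) x) {x : M}
    (hx : x ∈ (chartAt (EuclideanSpace ℝ (Fin n)) p).source) :
    fieldInChart (chartAt (EuclideanSpace ℝ (Fin n)) p) X
      (chartAt (EuclideanSpace ℝ (Fin n)) p x) = 0 ↔ X x = 0 := by
  unfold fieldInChart
  rw [(chartAt (EuclideanSpace ℝ (Fin n)) p).left_inv hx]
  exact map_eq_zero_iff _ ((mdifferentiable_chartAt (n := n) p).mfderiv_injective hx)

/-- The unrestricted tangent map of a map that is smooth on an open set is smooth over that set. -/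
lemma contMDiffOn_tangentMap_of_isOpen {m : ℕ} {N N' : Type*} [TopologicalSpace N]
    [ChartedSpace (EuclideanSpace ℝ (Fin n)) N] [TopologicalSpace N']
    [ChartedSpace (EuclideanSpace ℝ (Fin m)) N'] [IsManifold (𝓡 n) ∞ N] [IsManifold (𝓡 m) ∞ N']
    {f : N → N'} {s : Set N} (hs : IsOpen s) (hf : ContMDiffOn (𝓡 n) (𝓡 m) ∞ f s) :
    ContMDiffOn (𝓡 n).tangent (𝓡 m).tangent ∞ (tangentMap (𝓡 n) (𝓡 m) f)
      (Bundle.TotalSpace.proj ⁻¹' s) := by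
  have : IsManifold (𝓡 n) 1 N := IsManifold.of_le (n := ∞) (by simp)
  have : IsManifold (𝓡 m) 1 N' := IsManifold.of_le (n := ∞) (by simp)
  refine (hf.contMDiffOn_tangentMapWithin (m := ∞) (by simp) hs.uniqueMDiffOn).congr
    fun z hz ↦ ?_
  exact (tangentMapWithin_eq_tangentMap (hs.uniqueMDiffOn _ hz)
    (((hf _ hz).contMDiffAt (hs.mem_nhds hz)).mdifferentiableAt (by simp))).symm

lemma contDiffOn_fieldInChart (p : M) {X : ∀ x : M, TangentSpace (𝓡 n) x}
    (hX : ContMDiff (𝓡 n) (𝓡 n).tangent ∞ (fun x : M ↦ (⟨x, X x⟩ : TangentBundle (𝓡 n) M))) :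
    ContDiffOn ℝ ∞ (fieldInChart (chartAt (EuclideanSpace ℝ (Fin n)) p) X)
      (chartAt (EuclideanSpace ℝ (Fin n)) p).target := by
  set e := chartAt (EuclideanSpace ℝ (Fin n)) p
  have h1 := contMDiffOn_tangentMap_of_isOpen e.open_source
    (contMDiffOn_chart (I := 𝓡 n) (n := ∞) (x := p))
  have h2 : ContMDiffOn (𝓡 n) (𝓡 n).tangent ∞
      (fun y ↦ (⟨e.symm y, X (e.symm y)⟩ : TangentBundle (𝓡 n) M)) e.target :=
    hX.comp_contMDiffOn (contMDiffOn_chart_symm (I := 𝓡 n) (n := ∞) (x := p))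
  have h3 := h1.comp h2 (fun y hy ↦ e.map_target hy)
  exact ((contMDiff_snd_tangentBundle_modelSpace _ (𝓡 n)).comp_contMDiffOn h3).contDiffOn

lemma contDiffOn_metricInChart (g : PseudoRiemannianMetric n M) (p : M) :
    ContDiffOn ℝ ∞ (metricInChart g (chartAt (EuclideanSpace ℝ (Fin n)) p))
      (chartAt (EuclideanSpace ℝ (Fin n)) p).target := by
  refine contDiffOn_clm_apply.2 fun u ↦ contDiffOn_clm_apply.2 fun v ↦ ?_
  set e := chartAt (EuclideanSpace ℝ (Fin n)) p
  have hes := contMDiffOn_chart_symm (I := 𝓡 n) (n := ∞) (x := p)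
  have h1 := contMDiffOn_tangentMap_of_isOpen e.open_target hes
  have h2 : ∀ w : EuclideanSpace ℝ (Fin n), ContMDiffOn (𝓡 n) (𝓡 n).tangent ∞
      (fun y ↦ (⟨e.symm y, mfderiv (𝓡 n) (𝓡 n) e.symm y w⟩ : TangentBundle (𝓡 n) M))
      e.target := fun w ↦
    h1.comp (contMDiff_vectorSpace_iff_contDiff.2 (contDiff_const (c := w))).contMDiffOn
      (fun y hy ↦ hy)
  have h3 := g.form_smooth.comp_contMDiffOn hes
  have h4 : ContMDiffOn (𝓡 n) ((𝓡 n).prod 𝓘(ℝ, ℝ)) ∞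
      (fun y ↦ (⟨e.symm y, metricInChart g e y u v⟩ : Bundle.TotalSpace ℝ (Bundle.Trivial M ℝ)))
      e.target :=
    ContMDiffOn.clm_bundle_apply₂ (F₁ := EuclideanSpace ℝ (Fin n))
      (F₂ := EuclideanSpace ℝ (Fin n)) (F₃ := ℝ) (E₃ := Bundle.Trivial M ℝ) h3 (h2 u) (h2 v)
  refine ContMDiffOn.contDiffOn fun y hy ↦ ?_
  simpa using (Bundle.contMDiffWithinAt_totalSpace.1 (h4 y hy)).2

end Charts

/-! ### The space of Killing fields of a manifold -/

section Killing

variable {n : ℕ} {M : Type*} [TopologicalSpace M]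
  [ChartedSpace (EuclideanSpace ℝ (Fin n)) M] [IsManifold (𝓡 n) ∞ M]

lemma EuclideanSpace.eq_sum_smul_single (z : EuclideanSpace ℝ (Fin n)) :
    z = ∑ s, z s • EuclideanSpace.single s (1 : ℝ) := by
  simpa using ((EuclideanSpace.basisFun (Fin n) ℝ).sum_repr z).symm

/-- The left-hand side of the Killing equation at a point `y`, as a bilinear form. -/
def lieDerivForm {E : Type*} [NormedAddCommGroup E] [NormedSpace ℝ E]
    (G : E → E →L[ℝ] E →L[ℝ] ℝ) (X : E → E) (y : E) : E →ₗ[ℝ] E →ₗ[ℝ] ℝ :=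
  LinearMap.mk₂ ℝ
    (fun u v ↦ fderiv ℝ G y (X y) u v + G y (fderiv ℝ X y u) v + G y u (fderiv ℝ X y v))
    (fun u u' v ↦ by simp only [map_add, add_apply]; ring)
    (fun c u v ↦ by simp only [map_smul, smul_apply, smul_eq_mul]; ring)
    (fun u v v' ↦ by simp only [map_add]; ring)
    (fun c u v ↦ by simp only [map_smul, smul_eq_mul]; ring)

/-- The component form of the Killing equation in a chart, extended bilinearly from the coordinate
vectors to all vectors. -/
lemma IsKillingField.killingOn {g : PseudoRiemannianMetric n M}
    {X : ∀ x : M, TangentSpace (𝓡 n) x} (hX : IsKillingField g X) (p : M) :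
    KillingOn (metricInChart g (chartAt (EuclideanSpace ℝ (Fin n)) p))
      (fieldInChart (chartAt (EuclideanSpace ℝ (Fin n)) p) X)
      (chartAt (EuclideanSpace ℝ (Fin n)) p).target := by
  intro y hy
  set e := chartAt (EuclideanSpace ℝ (Fin n)) p with he
  have hGd : DifferentiableAt ℝ (metricInChart g e) y :=
    ((contDiffOn_metricInChart g p).contDiffAt (e.open_target.mem_nhds hy)).differentiableAt
      (by simp)
  have hXd : DifferentiableAt ℝ (fieldInChart e X) y :=
    ((contDiffOn_fieldInChart p hX.smooth).contDiffAt
      (e.open_target.mem_nhds hy)).differentiableAt (by simp)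
  have hdG : ∀ s i j, partialDeriv s (metricComponent g e i j) y =
      fderiv ℝ (metricInChart g e) y (EuclideanSpace.single s 1) (EuclideanSpace.single i 1)
        (EuclideanSpace.single j 1) := by
    intro s i j
    have h := (hGd.hasFDerivAt.clm_apply
      (hasFDerivAt_const (EuclideanSpace.single i (1 : ℝ)) y)).clm_apply
      (hasFDerivAt_const (EuclideanSpace.single j (1 : ℝ)) y)
    have h' : HasFDerivAt (metricComponent g e i j) _ y := h
    rw [partialDeriv, h'.fderiv]
    simp
  have hdX : ∀ i s, partialDeriv i (vectorComponent e X s) y =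
      fderiv ℝ (fieldInChart e X) y (EuclideanSpace.single i 1) s := by
    intro i s
    have h' : HasFDerivAt (vectorComponent e X s) _ y :=
      (EuclideanSpace.proj s : EuclideanSpace ℝ (Fin n) →L[ℝ] ℝ).hasFDerivAt.comp y
        hXd.hasFDerivAt
    rw [partialDeriv, h'.fderiv]
    simp
  have hB : lieDerivForm (metricInChart g e) (fieldInChart e X) y = 0 := by
    refine (EuclideanSpace.basisFun (Fin n) ℝ).toBasis.ext fun i ↦
      (EuclideanSpace.basisFun (Fin n) ℝ).toBasis.ext fun j ↦ ?_
    have h := hX.lieDeriv_eq_zero e (chart_mem_atlas _ p) y hy i j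
    simp only [lieDerivMetricComponent, hdG, hdX] at h
    simp only [OrthonormalBasis.coe_toBasis, EuclideanSpace.basisFun_apply, lieDerivForm,
      LinearMap.mk₂_apply, LinearMap.zero_apply]
    rw [← h]
    congr 1
    · congr 1
      · conv_lhs => rw [EuclideanSpace.eq_sum_smul_single (fieldInChart e X y)]
        simp only [map_sum, map_smul, sum_apply,
          smul_apply, smul_eq_mul]
        rfl
      · conv_lhs => rw [EuclideanSpace.eq_sum_smul_single
          (fderiv ℝ (fieldInChart e X) y (EuclideanSpace.single i 1))]
        simp only [map_sum, map_smul, sum_apply,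
          smul_apply, smul_eq_mul]
        exact Finset.sum_congr rfl fun s _ ↦ mul_comm _ _
    · conv_lhs => rw [EuclideanSpace.eq_sum_smul_single
        (fderiv ℝ (fieldInChart e X) y (EuclideanSpace.single j 1))]
      simp only [map_sum, map_smul, smul_eq_mul]
      exact Finset.sum_congr rfl fun s _ ↦ mul_comm _ _
  intro u v
  exact LinearMap.congr_fun₂ hB u v

/-- The real vector space of the vector fields which, in every preferred chart of the manifold, are
smooth and satisfy the coordinate-free Killing equation `KillingOn`. -/
def killingSubmodule (g : PseudoRiemannianMetric n M) :
    Submodule ℝ (∀ x : M, TangentSpace (𝓡 n) x) where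
  carrier := {X | ∀ p : M,
    ContDiffOn ℝ ∞ (fieldInChart (chartAt (EuclideanSpace ℝ (Fin n)) p) X)
      (chartAt (EuclideanSpace ℝ (Fin n)) p).target ∧
    KillingOn (metricInChart g (chartAt (EuclideanSpace ℝ (Fin n)) p))
      (fieldInChart (chartAt (EuclideanSpace ℝ (Fin n)) p) X)
      (chartAt (EuclideanSpace ℝ (Fin n)) p).target}
  add_mem' := by
    intro X Y hX hY p
    rw [fieldInChart_add]
    refine ⟨(hX p).1.add (hY p).1, fun y hy u v ↦ ?_⟩
    have hy' := (chartAt (EuclideanSpace ℝ (Fin n)) p).open_target.mem_nhds hy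
    have h1 := (hX p).2 y hy u v
    have h2 := (hY p).2 y hy u v
    rw [fderiv_add (((hX p).1.contDiffAt hy').differentiableAt (by simp))
      (((hY p).1.contDiffAt hy').differentiableAt (by simp))]
    simp only [Pi.add_apply, map_add, add_apply]
    linarith
  zero_mem' := by
    intro p
    have h : fieldInChart (chartAt (EuclideanSpace ℝ (Fin n)) p)
        (0 : ∀ x : M, TangentSpace (𝓡 n) x) = 0 := funext fun y ↦ map_zero
          (mfderiv (𝓡 n) (𝓡 n) (chartAt (EuclideanSpace ℝ (Fin n)) p) _)
    rw [h]
    exact ⟨contDiffOn_const (c := 0), fun y hy u v ↦ by simp⟩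
  smul_mem' := by
    intro c X hX p
    rw [fieldInChart_smul]
    refine ⟨contDiffOn_const.smul (hX p).1, fun y hy u v ↦ ?_⟩
    have hy' := (chartAt (EuclideanSpace ℝ (Fin n)) p).open_target.mem_nhds hy
    have h1 := (hX p).2 y hy u v
    rw [fderiv_const_smul (((hX p).1.contDiffAt hy').differentiableAt (by simp))]
    simp only [Pi.smul_apply, map_smul, smul_apply, smul_eq_mul]
    linear_combination c * h1

lemma IsKillingField.mem_killingSubmodule {g : PseudoRiemannianMetric n M}
    {X : ∀ x : M, TangentSpace (𝓡 n) x} (hX : IsKillingField g X) : X ∈ killingSubmodule g :=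
  fun p ↦ ⟨contDiffOn_fieldInChart p hX.smooth, hX.killingOn p⟩

lemma exists_isOpen_killingSubmodule_eq_zero (g : PseudoRiemannianMetric n M) (p : M) :
    ∃ W ⊆ (chartAt (EuclideanSpace ℝ (Fin n)) p).source, IsOpen W ∧ p ∈ W ∧
      ∀ X ∈ killingSubmodule g, ∀ q ∈ W,
        fieldInChart (chartAt (EuclideanSpace ℝ (Fin n)) p) X
          (chartAt (EuclideanSpace ℝ (Fin n)) p q) = 0 →
        fderiv ℝ (fieldInChart (chartAt (EuclideanSpace ℝ (Fin n)) p) X)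
          (chartAt (EuclideanSpace ℝ (Fin n)) p q) = 0 →
        ∀ x ∈ W, X x = 0 := by
  set e := chartAt (EuclideanSpace ℝ (Fin n)) p
  have hp : p ∈ e.source := mem_chart_source _ p
  have h2 : (2 : WithTop ℕ∞) ≤ ∞ := WithTop.coe_le_coe.2 (le_top : (2 : ℕ∞) ≤ ⊤)
  obtain ⟨V, -, hVo, hpV, hV⟩ := exists_isOpen_killing_eq_zero e.open_target
    ((contDiffOn_metricInChart g p).of_le h2)
    (fun y _ u v ↦ metricInChart_symm g e y u v) (e.map_source hp)
    (fun u hu ↦ metricInChart_nondegenerate g p (e.map_source hp) hu)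
  refine ⟨e.source ∩ e ⁻¹' V, inter_subset_left, e.isOpen_inter_preimage hVo, ⟨hp, hpV⟩, ?_⟩
  intro X hX q hq h0 h1 x hx
  exact (fieldInChart_eq_zero_iff p X hx.1).1
    (hV _ ((hX p).1.of_le h2) (hX p).2 (e q) hq.2 h0 h1 (e x) hx.2)

/-- On a connected manifold a Killing field is determined by its first jet at one point: the set of
points near which the field vanishes is open and closed. -/
lemma eq_zero_of_mem_killingSubmodule [ConnectedSpace M] {g : PseudoRiemannianMetric n M} {p : M}
    {X : ∀ x : M, TangentSpace (𝓡 n) x} (hX : X ∈ killingSubmodule g)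
    (h0 : fieldInChart (chartAt (EuclideanSpace ℝ (Fin n)) p) X
      (chartAt (EuclideanSpace ℝ (Fin n)) p p) = 0)
    (h1 : fderiv ℝ (fieldInChart (chartAt (EuclideanSpace ℝ (Fin n)) p) X)
      (chartAt (EuclideanSpace ℝ (Fin n)) p p) = 0) : X = 0 := by
  have hopen : IsOpen {x : M | ∀ᶠ z in 𝓝 x, X z = 0} := isOpen_setOfPred_eventually_nhds
  have hclosed : IsClosed {x : M | ∀ᶠ z in 𝓝 x, X z = 0} := by
    refine isClosed_of_closure_subset fun x hx ↦ ?_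
    obtain ⟨W, hWs, hWo, hxW, hW⟩ := exists_isOpen_killingSubmodule_eq_zero g x
    obtain ⟨q, hqW, hq⟩ := mem_closure_iff.1 hx W hWo hxW
    set e := chartAt (EuclideanSpace ℝ (Fin n)) x
    have hqs := hWs hqW
    have hc : Tendsto e.symm (𝓝 (e q)) (𝓝 q) := by
      simpa [e.left_inv hqs] using (e.continuousAt_symm (e.map_source hqs)).tendsto
    have hev : fieldInChart e X =ᶠ[𝓝 (e q)] fun _ ↦ 0 := by
      filter_upwards [hc.eventually hq] with y hy
      unfold fieldInChart
      rw [hy]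
      exact map_zero (mfderiv (𝓡 n) (𝓡 n) e (e.symm y))
    have hz := hW X hX q hqW hev.eq_of_nhds (by rw [hev.fderiv_eq]; simp)
    filter_upwards [hWo.mem_nhds hxW] with z hzW using hz z hzW
  have hne : {x : M | ∀ᶠ z in 𝓝 x, X z = 0}.Nonempty := by
    obtain ⟨W, -, hWo, hpW, hW⟩ := exists_isOpen_killingSubmodule_eq_zero g p
    refine ⟨p, ?_⟩
    filter_upwards [hWo.mem_nhds hpW] with z hzW using hW X hX p hpW h0 h1 z hzW
  have huniv := IsClopen.eq_univ ⟨hclosed, hopen⟩ hne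
  funext x
  have hx : x ∈ {x : M | ∀ᶠ z in 𝓝 x, X z = 0} := huniv ▸ mem_univ x
  exact hx.self_of_nhds

/-! ### Counting the entries of the first jet -/

/-- The index set of the independent entries of the first jet of a Killing field at a point: the
`n` components of the field and the `n(n-1)/2` entries above the diagonal of the matrix
`G(∂ᵢX, ∂ⱼ)`. -/
abbrev JetIndex (n : ℕ) : Type := Fin n ⊕ {q : Fin n × Fin n // q.1 < q.2}

/-- The independent entries of the first jet at `p` of a Killing field: its components `Xⁱ`, and
the numbers `G(∂ᵢX, ∂ⱼ)` with `i < j`. -/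
def killingJet (g : PseudoRiemannianMetric n M) (p : M) :
    killingSubmodule g →ₗ[ℝ] JetIndex n → ℝ where
  toFun X := Sum.elim
    (fun i ↦ fieldInChart (chartAt (EuclideanSpace ℝ (Fin n)) p) X.1
      (chartAt (EuclideanSpace ℝ (Fin n)) p p) i)
    (fun q ↦ metricInChart g (chartAt (EuclideanSpace ℝ (Fin n)) p)
      (chartAt (EuclideanSpace ℝ (Fin n)) p p)
      (fderiv ℝ (fieldInChart (chartAt (EuclideanSpace ℝ (Fin n)) p) X.1)
        (chartAt (EuclideanSpace ℝ (Fin n)) p p) (EuclideanSpace.single q.1.1 1))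
      (EuclideanSpace.single q.1.2 1))
  map_add' X Y := by
    have hy := (chartAt (EuclideanSpace ℝ (Fin n)) p).open_target.mem_nhds
      ((chartAt (EuclideanSpace ℝ (Fin n)) p).map_source (mem_chart_source _ p))
    funext k
    rcases k with i | q
    · simp [fieldInChart_add]
    · simp only [Submodule.coe_add, fieldInChart_add, Sum.elim_inr, Pi.add_apply]
      rw [fderiv_add (((X.2 p).1.contDiffAt hy).differentiableAt (by simp))
        (((Y.2 p).1.contDiffAt hy).differentiableAt (by simp))]
      simp
  map_smul' c X := by
    have hy := (chartAt (EuclideanSpace ℝ (Fin n)) p).open_target.mem_nhds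
      ((chartAt (EuclideanSpace ℝ (Fin n)) p).map_source (mem_chart_source _ p))
    funext k
    rcases k with i | q
    · simp [fieldInChart_smul]
    · simp only [Submodule.coe_smul, fieldInChart_smul, Sum.elim_inr, Pi.smul_apply]
      rw [fderiv_const_smul (((X.2 p).1.contDiffAt hy).differentiableAt (by simp))]
      simp

/-- If `X` vanishes at `p`, the Killing equation at `p` says that the matrix `G(∂ᵢX, ∂ⱼ)` is
skew-symmetric, so that its entries above the diagonal determine it; the first jet at `p` then
determines `X`. -/
lemma killingJet_injective [ConnectedSpace M] (g : PseudoRiemannianMetric n M) (p : M) :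
    Function.Injective (killingJet g p) := by
  refine (injective_iff_map_eq_zero _).2 fun X hX ↦ ?_
  set e := chartAt (EuclideanSpace ℝ (Fin n)) p with he
  have hp : e p ∈ e.target := e.map_source (mem_chart_source _ p)
  have h0 : fieldInChart e X.1 (e p) = 0 := by
    ext i
    exact congrFun hX (Sum.inl i)
  have hpair : ∀ i j, i < j → metricInChart g e (e p)
      (fderiv ℝ (fieldInChart e X.1) (e p) (EuclideanSpace.single i 1))
      (EuclideanSpace.single j 1) = 0 := fun i j hij ↦ congrFun hX (Sum.inr ⟨(i, j), hij⟩)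
  have hskew : ∀ i j, metricInChart g e (e p)
      (fderiv ℝ (fieldInChart e X.1) (e p) (EuclideanSpace.single i 1))
      (EuclideanSpace.single j 1) + metricInChart g e (e p)
      (fderiv ℝ (fieldInChart e X.1) (e p) (EuclideanSpace.single j 1))
      (EuclideanSpace.single i 1) = 0 := by
    intro i j
    have h := (X.2 p).2 (e p) hp (EuclideanSpace.single i 1) (EuclideanSpace.single j 1)
    rw [← he, h0, metricInChart_symm g e (e p) (EuclideanSpace.single i 1)] at h
    simpa using h
  have hall : ∀ i j, metricInChart g e (e p)
      (fderiv ℝ (fieldInChart e X.1) (e p) (EuclideanSpace.single i 1))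
      (EuclideanSpace.single j 1) = 0 := by
    intro i j
    rcases lt_trichotomy i j with h | rfl | h
    · exact hpair i j h
    · linarith [hskew i i]
    · linarith [hskew i j, hpair j i h]
  have h1 : fderiv ℝ (fieldInChart e X.1) (e p) = 0 := by
    ext u : 1
    refine metricInChart_nondegenerate g p hp fun v ↦ ?_
    rw [EuclideanSpace.eq_sum_smul_single u, EuclideanSpace.eq_sum_smul_single v]
    simp only [map_sum, map_smul, sum_apply, smul_apply]
    refine Finset.sum_eq_zero fun i _ ↦ ?_
    simp [← he, hall]
  exact Subtype.ext (eq_zero_of_mem_killingSubmodule X.2 h0 h1)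

end Killing

end

/-- A connected four-dimensional space-time manifold has at most ten Killing vector fields which
are linearly independent over `ℝ`. -/
theorem theorem3p1 {M : Type*} [TopologicalSpace M]
    [ChartedSpace (EuclideanSpace ℝ (Fin 4)) M] [IsManifold (𝓡 4) ∞ M] [ConnectedSpace M]
    (g : PseudoRiemannianMetric 4 M)
    {ι : Type*} (X : ι → ∀ x : M, TangentSpace (𝓡 4) x)
    (hX : ∀ a, IsKillingField g (X a)) (hlin : LinearIndependent ℝ X) :
    ENat.card ι ≤ 10 := by
  obtain ⟨p⟩ := (inferInstance : Nonempty M)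
  have h1 : LinearIndependent ℝ
      (fun a ↦ (⟨X a, (hX a).mem_killingSubmodule⟩ : killingSubmodule g)) :=
    LinearIndependent.of_comp (killingSubmodule g).subtype hlin
  have h2 := h1.map' (killingJet g p) (LinearMap.ker_eq_bot.2 (killingJet_injective g p))
  have := h2.finite
  have := Fintype.ofFinite ι
  have h3 := h2.fintype_card_le_finrank
  have hcard : Fintype.card (JetIndex 4) = 10 := by decide
  rw [Module.finrank_fintype_fun_eq_card, hcard] at h3
  rw [ENat.card_eq_coe_fintype_card]
  exact_mod_cast h3
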